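/- For $a\in\mathbb{R}$ let $G_a:\mathbb{R}\to\mathbb{R}^3$ be the curve determined by $G_a'=T$ together with the Frenet system with curvature $a$ and torsion $s/2$, $$T'=a\,n,\qquad n'=-a\,T+\tfrac s2\,b,\qquad b'=-\tfrac s2\,n,$$ with initial data $G_a(0)=2a(0,0,1)$, $T(0)=(1,0,0)$, $n(0)=(0,1,0)$, $b(0)=(0,0,1)$ (so that $\chi(s,t)=\sqrt t\,G_a(s/\sqrt t)$, $t>0$, is a self-similar solution of the binormal flow $\chi_t=\chi_s\wedge\chi_{ss}$), and put $$A_a^{\pm}=\lim_{s\to\pm\infty}\frac{G_a(s)}{s}.$$ For every $a\in\mathbb{R}$ the curve $G_a$ exists and is unique, and both limits exist. Moreover: (i) $A_a^+\neq -A_a^-$ for every $a\in\mathbb{R}$. (ii) $A_a^+=A_a^-$ if and only if $a=0$. (iii) There are real numbers $\tilde a>0$ and $\tilde{\tilde a}$ such that $G_a$ has no self-intersection if $|a|<\tilde a$, while $G_a$ has at least one and only finitely many self-intersections if $|a|>\tilde{\tilde a}$. Here a self-intersection is a pair $s_1<s_2$ with $G_a(s_1)=G_a(s_2)$. -/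

import Mathlib

/-- Three-dimensional Euclidean space. -/
abbrev E3 : Type := EuclideanSpace ℝ (Fin 3)

/-- `G` is a curve with velocity `T`, and `(T, n, b)` solves the Frenet system with curvature `a`
and torsion `s / 2`; at `s = 0` the frame is the standard basis and `G 0 = 2 a (0, 0, 1)`. -/
structure IsFrenetSolution (a : ℝ) (G T n b : ℝ → E3) : Prop where
  deriv_G : ∀ s, HasDerivAt G (T s) s
  deriv_T : ∀ s, HasDerivAt T (a • n s) s
  deriv_n : ∀ s, HasDerivAt n (-(a • T s) + (s / 2) • b s) s
  deriv_b : ∀ s, HasDerivAt b (-((s / 2) • n s)) s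
  G_zero : G 0 = (2 * a) • (!₂[0, 0, 1] : E3)
  T_zero : T 0 = !₂[1, 0, 0]
  n_zero : n 0 = !₂[0, 1, 0]
  b_zero : b 0 = !₂[0, 0, 1]

/-- `G` is the curve obtained from the Frenet system with parameter `a`. -/
def IsProfile (a : ℝ) (G : ℝ → E3) : Prop :=
  ∃ T n b : ℝ → E3, IsFrenetSolution a G T n b

/-- The profile `G_a` of the self-similar solution `√t G_a (s / √t)` of the binormal flow:
the curve that satisfies `IsProfile a`. -/
noncomputable def profile (a : ℝ) : ℝ → E3 :=
  Classical.epsilon (IsProfile a)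

/-- `A⁺_a`, the limit of `G_a(s) / s` as `s → +∞`. -/
noncomputable def Aplus (a : ℝ) : E3 :=
  Filter.limUnder Filter.atTop (fun s : ℝ => s⁻¹ • profile a s)

/-- `A⁻_a`, the limit of `G_a(s) / s` as `s → -∞`. -/
noncomputable def Aminus (a : ℝ) : E3 :=
  Filter.limUnder Filter.atBot (fun s : ℝ => s⁻¹ • profile a s)

/-- The self-intersections of a parametrized curve: the pairs of distinct parameters, in
increasing order, at which the curve passes through the same point. -/
def selfIntersections (γ : ℝ → E3) : Set (ℝ × ℝ) :=
  {p | p.1 < p.2 ∧ γ p.1 = γ p.2}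

/-! The curve has the closed form `G = s T + 2 a b`: differentiating, the normal terms cancel and
leave `T`. Orthonormality gives `‖G s‖ ^ 2 = s ^ 2 + 4 a ^ 2`, so a self-intersection can only pair
`-s` with `s`. Since the first coordinate of `G` is odd and the other two are even,
self-intersections correspond to positive zeros of the first coordinate `G₁`. The same symmetry
makes `A⁻` the image of `A⁺` under the reflection `(x, y, z) ↦ (x, -y, -z)`. Both vectors are unit,
so (i) and (ii) follow from the value `exp (-π a ^ 2 / 2)` of the first coordinate of `A⁺`.

To find that value, the frame is written quadratically in a spinor `(w, q)`, with `T₁ = 2 ‖w‖ ^ 2 -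
1`. At infinity `w` behaves like `c s ^ (i a ^ 2 / 2)`. Its Gaussian average `∫ exp (-r ^ 2) w (x r)
dr` over the half-line solves a first-order equation in `x` and is a multiple of `(1 + i x ^ 2 / 4)
^ (i a ^ 2 / 4)` (`gaussianAverage_eq`). As `x → ∞`, the same average is asymptotic to `c` times a
Gamma value, up to phase; comparing moduli gives `‖c‖` (`tendsto_norm_w_sq`).

For (iii), small curvature keeps `G₁` positive (`curve_zero_pos_of_small`), and large curvature
makes the curve follow a circle long enough for `G₁` to change sign (`exists_curve_zero_eq_zero`).
For `a ≠ 0` the zeros of `G₁` are isolated and bounded, hence finite in number. -/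

open Complex Filter Topology MeasureTheory Set

/-! ### Power series with factorially bounded coefficients -/

/-- A complex power series with coefficients bounded by `D C ^ k / k!` converges on the real line. -/
theorem summable_powerSeries_of_factorial_bound {c : ℕ → ℂ} {C D : ℝ}
    (hc : ∀ k, ‖c k‖ ≤ D * (C ^ k / k.factorial)) (x : ℝ) :
    Summable fun k => c k * (x : ℂ) ^ k := by
  refine Summable.of_norm_bounded ((Real.summable_pow_div_factorial (C * |x|)).mul_left D) ?_
  intro k
  rw [norm_mul, norm_pow, Complex.norm_real, Real.norm_eq_abs, mul_pow]
  calc ‖c k‖ * |x| ^ k ≤ D * (C ^ k / k.factorial) * |x| ^ k := by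
        gcongr; exact hc k
    _ = _ := by ring

/-- Termwise differentiation of a complex power series with coefficients bounded by
`D C ^ k / k!`. -/
theorem hasDerivAt_powerSeries_of_factorial_bound {c : ℕ → ℂ} {C D : ℝ}
    (hc : ∀ k, ‖c k‖ ≤ D * (C ^ k / k.factorial)) (x : ℝ) :
    HasDerivAt (fun y : ℝ => ∑' k, c k * (y : ℂ) ^ k)
      (∑' k, (k + 1) * c (k + 1) * (x : ℂ) ^ k) x := by
  -- The derivative series has a uniform summable majorant only on bounded sets, so the argument is
  -- local, on a ball containing `0` and `x`.
  obtain ⟨R, hR⟩ : ∃ R, |x| < R := exists_gt _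
  have hR0 : 0 < R := (abs_nonneg x).trans_lt hR
  have hu : Summable fun k : ℕ => ‖c k‖ * (k * R ^ (k - 1)) := by
    rw [← summable_nat_add_iff 1]
    refine Summable.of_nonneg_of_le (fun k => by positivity) (fun k => ?_)
      ((Real.summable_pow_div_factorial (C * R)).mul_left (D * C))
    calc ‖c (k + 1)‖ * ((k + 1 : ℕ) * R ^ (k + 1 - 1))
        ≤ D * (C ^ (k + 1) / (k + 1).factorial) * ((k + 1 : ℕ) * R ^ (k + 1 - 1)) := by
          gcongr; exact hc _
      _ = D * C * ((C * R) ^ k / k.factorial) := by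
          rw [Nat.factorial_succ, Nat.add_sub_cancel]
          push_cast
          field_simp
          ring
  have key := hasDerivAt_tsum_of_isPreconnected (g := fun k (y : ℝ) => c k * (y : ℂ) ^ k)
    (g' := fun k (y : ℝ) => c k * (k * (y : ℂ) ^ (k - 1))) (y₀ := 0) (y := x) hu
    (Metric.isOpen_ball (x := (0 : ℝ)) (ε := R)) (convex_ball (0 : ℝ) R).isPreconnected
    (fun k y _ => by
      have := (Complex.ofRealCLM.hasDerivAt (x := y)).pow k
      simpa using this.const_mul (c k))
    (fun k y hy => by
      have hy' : |y| ≤ R := by simpa using (mem_ball_zero_iff.mp hy).le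
      rw [norm_mul, norm_mul, norm_pow, Complex.norm_real, Complex.norm_natCast]
      gcongr
      exact hy')
    (by simpa using hR0) (summable_powerSeries_of_factorial_bound hc 0) (by simpa using hR)
  refine key.congr_deriv ?_
  have hs : Summable fun k : ℕ => c k * (k * (x : ℂ) ^ (k - 1)) := by
    refine Summable.of_norm_bounded hu fun k => ?_
    rw [norm_mul, norm_mul, norm_pow, Complex.norm_real, Complex.norm_natCast]
    gcongr
    exact hR.le
  rw [hs.tsum_eq_zero_add]
  simp only [Nat.cast_zero, zero_mul, mul_zero, zero_add, Nat.add_sub_cancel]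
  refine tsum_congr fun k => ?_
  push_cast
  ring

/-! ### The spinor system and its solution -/

/-- The spinor form of the Frenet system with curvature `a` and torsion `s / 2`. -/
structure IsSpinorSolution (a : ℝ) (w q : ℝ → ℂ) : Prop where
  deriv_w : ∀ s, HasDerivAt w (a / 2 * q s) s
  deriv_q : ∀ s, HasDerivAt q (-(a / 2 * w s) - I * (s / 2) * q s) s
  w_zero : w 0 = 1
  q_zero : q 0 = 0
  w_even : ∀ s, w (-s) = w s
  q_odd : ∀ s, q (-s) = -q s

/-- The coefficients of the odd component of the spinor solution. -/
noncomputable def spinorCoeff (a : ℝ) : ℕ → ℂ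
  | 0 => -(a / 2)
  | k + 1 => -((a ^ 2 / (8 * (k + 1)) + I / 2) / (2 * k + 3)) * spinorCoeff a k

/-- The coefficients of the even component of the spinor solution. -/
noncomputable def spinorCoeffEven (a : ℝ) : ℕ → ℂ
  | 0 => 1
  | k + 1 => a / (4 * (k + 1)) * spinorCoeff a k

theorem norm_spinorCoeff_le (a : ℝ) (k : ℕ) :
    ‖spinorCoeff a k‖ ≤ |a| / 2 * ((a ^ 2 + 1) ^ k / k.factorial) := by
  induction k with
  | zero => simp [spinorCoeff]
  | succ k ih =>
    have h1 : ‖(a ^ 2 / (8 * (k + 1)) + I / 2 : ℂ)‖ ≤ a ^ 2 + 1 := by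
      refine (norm_add_le _ _).trans ?_
      have : ‖(a ^ 2 / (8 * (k + 1)) : ℂ)‖ = a ^ 2 / (8 * (k + 1)) := by
        rw [show (a ^ 2 / (8 * (k + 1)) : ℂ) = ((a ^ 2 / (8 * (k + 1)) : ℝ) : ℂ) by push_cast; rfl,
          Complex.norm_real, Real.norm_of_nonneg (by positivity)]
      rw [this]
      have h2 : a ^ 2 / (8 * (k + 1)) ≤ a ^ 2 :=
        div_le_self (sq_nonneg a) (by have : (0 : ℝ) ≤ k := k.cast_nonneg
                                      linarith)
      have h3 : ‖(I / 2 : ℂ)‖ = 1 / 2 := by simp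
      rw [h3]
      linarith
    have h4 : (k + 1 : ℝ) ≤ ‖(2 * k + 3 : ℂ)‖ := by
      rw [show (2 * k + 3 : ℂ) = ((2 * k + 3 : ℝ) : ℂ) by push_cast; rfl,
          Complex.norm_real, Real.norm_of_nonneg (by positivity)]
      have : (0 : ℝ) ≤ k := k.cast_nonneg
      linarith
    rw [spinorCoeff, norm_mul, norm_neg, norm_div]
    calc _ ≤ (a ^ 2 + 1) / (k + 1) * (|a| / 2 * ((a ^ 2 + 1) ^ k / k.factorial)) := by
          gcongr
      _ = _ := by
          rw [Nat.factorial_succ]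
          push_cast
          field_simp
          ring

theorem norm_spinorCoeffEven_le (a : ℝ) (k : ℕ) :
    ‖spinorCoeffEven a k‖ ≤ 1 * ((a ^ 2 + 1) ^ k / k.factorial) := by
  cases k with
  | zero => simp [spinorCoeffEven]
  | succ k =>
    have h : ‖(a / (4 * (k + 1)) : ℂ)‖ = |a| / (4 * (k + 1)) := by
      rw [show (a / (4 * (k + 1)) : ℂ) = ((a / (4 * (k + 1)) : ℝ) : ℂ) by push_cast; rfl,
        Complex.norm_real, Real.norm_eq_abs, abs_div, abs_of_pos (by positivity : (0:ℝ) < 4 * (k + 1))]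
    rw [spinorCoeffEven, norm_mul, h]
    calc _ ≤ |a| / (4 * (k + 1)) * (|a| / 2 * ((a ^ 2 + 1) ^ k / k.factorial)) := by
          gcongr
          exact norm_spinorCoeff_le a k
      _ = (|a| ^ 2 / 8) * (a ^ 2 + 1) ^ k / ((k + 1) * k.factorial) := by
          field_simp; ring
      _ ≤ (a ^ 2 + 1) * (a ^ 2 + 1) ^ k / ((k + 1) * k.factorial) := by
          gcongr
          rw [sq_abs]
          nlinarith [sq_nonneg a]
      _ = _ := by
          rw [Nat.factorial_succ]
          push_cast
          ring

/-- With `x = s ^ 2`, `w = F x` and `q = s D x`, the system becomes `F' = (a / 4) D` and `D + 2 x D'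
= -(a / 2) F - (i / 2) x D`. Comparing coefficients and eliminating those of `F` gives the recursion
of `spinorCoeff`. The form of the substitution supplies the parity. -/
theorem exists_isSpinorSolution (a : ℝ) : ∃ w q : ℝ → ℂ, IsSpinorSolution a w q := by
  set F : ℝ → ℂ := fun x => ∑' k, spinorCoeffEven a k * (x : ℂ) ^ k with hF
  set D : ℝ → ℂ := fun x => ∑' k, spinorCoeff a k * (x : ℂ) ^ k with hD
  set D' : ℝ → ℂ := fun x => ∑' k : ℕ, (k + 1) * spinorCoeff a (k + 1) * (x : ℂ) ^ k with hD'
  have dD : ∀ x, HasDerivAt D (D' x) x :=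
    hasDerivAt_powerSeries_of_factorial_bound (norm_spinorCoeff_le a)
  have dF : ∀ x, HasDerivAt F (a / 4 * D x) x := by
    intro x
    convert hasDerivAt_powerSeries_of_factorial_bound (norm_spinorCoeffEven_le a) x using 1
    rw [hD, ← tsum_mul_left]
    refine tsum_congr fun k => ?_
    have : (k + 1 : ℂ) ≠ 0 := by exact_mod_cast k.succ_ne_zero
    rw [spinorCoeffEven]
    field_simp
  have sD := summable_powerSeries_of_factorial_bound (norm_spinorCoeff_le a)
  have sF := summable_powerSeries_of_factorial_bound (norm_spinorCoeffEven_le a)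
  have sD' : ∀ x : ℝ, Summable fun k : ℕ => (k + 1) * spinorCoeff a (k + 1) * (x : ℂ) ^ k := by
    refine summable_powerSeries_of_factorial_bound
      (C := a ^ 2 + 1) (D := |a| / 2 * (a ^ 2 + 1)) fun k => ?_
    have h : ‖(k + 1 : ℂ)‖ = k + 1 := by
      rw [show (k + 1 : ℂ) = ((k + 1 : ℝ) : ℂ) by push_cast; rfl,
        Complex.norm_real, Real.norm_of_nonneg (by positivity)]
    rw [norm_mul, h]
    calc _ ≤ (k + 1 : ℝ) * (|a| / 2 * ((a ^ 2 + 1) ^ (k + 1) / (k + 1).factorial)) := by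
          gcongr
          exact norm_spinorCoeff_le a _
      _ = _ := by
          rw [Nat.factorial_succ]
          push_cast
          field_simp
          ring
  have rel : ∀ x : ℝ, D x + 2 * x * D' x = -(a / 2 * F x) - I / 2 * x * D x := by
    intro x
    have e1 : D x = spinorCoeff a 0 + x * ∑' k, spinorCoeff a (k + 1) * (x : ℂ) ^ k := by
      rw [← tsum_mul_left]
      refine (sD x).tsum_eq_zero_add.trans ?_
      simp only [pow_zero, mul_one]
      congr 1
      exact tsum_congr fun k => by ring
    have e2 : F x = 1 + x * ∑' k, spinorCoeffEven a (k + 1) * (x : ℂ) ^ k := by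
      rw [← tsum_mul_left]
      refine (sF x).tsum_eq_zero_add.trans ?_
      simp only [spinorCoeffEven, pow_zero, mul_one]
      congr 1
      exact tsum_congr fun k => by ring
    rcases eq_or_ne x 0 with rfl | hx
    · rw [e1, e2]
      simp [spinorCoeff]
    have hx' : (x : ℂ) ≠ 0 := by exact_mod_cast hx
    have s1 : Summable fun k => spinorCoeff a (k + 1) * (x : ℂ) ^ k := by
      have := ((summable_nat_add_iff 1).mpr (sD x)).mul_left (x : ℂ)⁻¹
      refine this.congr fun k => ?_
      rw [pow_succ]; field_simp
    have s2 : Summable fun k => spinorCoeffEven a (k + 1) * (x : ℂ) ^ k := by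
      have := ((summable_nat_add_iff 1).mpr (sF x)).mul_left (x : ℂ)⁻¹
      refine this.congr fun k => ?_
      rw [pow_succ]; field_simp
    -- The relation with its constant terms removed and divided by `x`; it now holds coefficient by
    -- coefficient.
    have e3 : (∑' k, spinorCoeff a (k + 1) * (x : ℂ) ^ k) + 2 * D' x =
        -(a / 2 * ∑' k, spinorCoeffEven a (k + 1) * (x : ℂ) ^ k) - I / 2 * D x := by
      rw [hD, hD', ← tsum_mul_left, ← tsum_mul_left, ← tsum_mul_left, ← tsum_neg,
        ← s1.tsum_add ((sD' x).mul_left 2), ← (s2.mul_left _).neg.tsum_sub ((sD x).mul_left _)]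
      refine tsum_congr fun k => ?_
      have h1 : (k + 1 : ℂ) ≠ 0 := by exact_mod_cast k.succ_ne_zero
      have h2 : (2 * k + 3 : ℂ) ≠ 0 := by exact_mod_cast (2 * k + 2).succ_ne_zero
      have h3 : (2 * k + 3) * spinorCoeff a (k + 1) =
          -(a ^ 2 / (8 * (k + 1)) + I / 2) * spinorCoeff a k := by
        rw [spinorCoeff, ← mul_assoc, mul_neg, mul_div_cancel₀ _ h2]
      have h4 : (a ^ 2 / (8 * (k + 1)) : ℂ) = a / 2 * (a / (4 * (k + 1))) := by
        field_simp
        ring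
      rw [spinorCoeffEven]
      linear_combination (x : ℂ) ^ k * h3 - (x : ℂ) ^ k * spinorCoeff a k * h4
    rw [e2]
    conv_lhs => rw [e1]
    have h0 : spinorCoeff a 0 = -(a / 2) := rfl
    rw [h0]
    linear_combination (x : ℂ) * e3
  have dsq : ∀ s : ℝ, HasDerivAt (fun s : ℝ => s ^ 2) (2 * s) s := fun s => by
    simpa using hasDerivAt_pow 2 s
  refine ⟨fun s => F (s ^ 2), fun s => s * D (s ^ 2), ?_, ?_, ?_, ?_, ?_, ?_⟩
  · intro s
    refine ((dF (s ^ 2)).scomp s (dsq s)).congr_deriv ?_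
    rw [Complex.real_smul]; push_cast; ring
  · intro s
    refine ((Complex.ofRealCLM.hasDerivAt (x := s)).mul
      ((dD (s ^ 2)).scomp s (dsq s))).congr_deriv ?_
    have := rel (s ^ 2)
    simp only [Complex.real_smul, Complex.ofRealCLM_apply, Function.comp]
    push_cast at this ⊢
    linear_combination this
  · simp only [hF]
    rw [tsum_eq_single 0 (fun k hk => by simp [hk])]
    simp [spinorCoeffEven]
  · simp
  · intro s; simp
  · intro s; simp

/-! ### The Frenet frame and the curve built from a spinor -/

theorem hasDerivAt_vec3 {f₀ f₁ f₂ : ℝ → ℝ} {d₀ d₁ d₂ s : ℝ} (h₀ : HasDerivAt f₀ d₀ s)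
    (h₁ : HasDerivAt f₁ d₁ s) (h₂ : HasDerivAt f₂ d₂ s) :
    HasDerivAt (fun t => (!₂[f₀ t, f₁ t, f₂ t] : E3)) !₂[d₀, d₁, d₂] s := by
  have h : HasDerivAt (fun t => ![f₀ t, f₁ t, f₂ t]) ![d₀, d₁, d₂] s := by
    rw [hasDerivAt_pi]
    intro i
    fin_cases i <;> simpa
  exact (PiLp.continuousLinearEquiv 2 ℝ (fun _ : Fin 3 => ℝ)).symm.hasFDerivAt.comp_hasDerivAt s h

theorem HasDerivAt.coord {F : ℝ → E3} {F' : E3} {s : ℝ} (h : HasDerivAt F F' s) (i : Fin 3) :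
    HasDerivAt (fun t => F t i) (F' i) s :=
  (EuclideanSpace.proj (𝕜 := ℝ) i).hasFDerivAt.comp_hasDerivAt s h

theorem HasDerivAt.complex_re {f : ℝ → ℂ} {f' : ℂ} {s : ℝ} (h : HasDerivAt f f' s) :
    HasDerivAt (fun t => (f t).re) f'.re s :=
  Complex.reCLM.hasFDerivAt.comp_hasDerivAt s h

theorem HasDerivAt.complex_im {f : ℝ → ℂ} {f' : ℂ} {s : ℝ} (h : HasDerivAt f f' s) :
    HasDerivAt (fun t => (f t).im) f'.im s :=
  Complex.imCLM.hasFDerivAt.comp_hasDerivAt s h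

theorem HasDerivAt.complex_conj {f : ℝ → ℂ} {f' : ℂ} {s : ℝ} (h : HasDerivAt f f' s) :
    HasDerivAt (fun t => (starRingEnd ℂ) (f t)) ((starRingEnd ℂ) f') s :=
  Complex.conjCLE.hasFDerivAt.comp_hasDerivAt s h

/-- The quadratic phase `exp (i s ^ 2 / 4)`. -/
noncomputable def quadPhase (s : ℝ) : ℂ := cexp (I * (s ^ 2 / 4))

theorem hasDerivAt_quadPhase (s : ℝ) : HasDerivAt quadPhase (I * (s / 2) * quadPhase s) s := by
  have h : HasDerivAt (fun t : ℝ => I * ((t : ℂ) ^ 2 / 4)) (I * (s / 2)) s := by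
    have := (((Complex.ofRealCLM.hasDerivAt (x := s)).pow 2).div_const 4).const_mul I
    refine this.congr_deriv ?_
    simp only [Complex.ofRealCLM_apply]
    push_cast
    ring
  exact h.cexp.congr_deriv (by rw [quadPhase]; ring)

theorem quadPhase_normSq (s : ℝ) : (quadPhase s).re ^ 2 + (quadPhase s).im ^ 2 = 1 := by
  have h : ‖quadPhase s‖ = 1 := by
    rw [quadPhase, show I * ((s : ℂ) ^ 2 / 4) = ((s ^ 2 / 4 : ℝ) : ℂ) * I by push_cast; ring]
    exact Complex.norm_exp_ofReal_mul_I _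
  have := Complex.sq_norm (quadPhase s)
  rw [h, Complex.normSq_apply] at this
  linarith

/-- The tangent vector built from a spinor. -/
noncomputable def spinorTangent (w q : ℝ → ℂ) (s : ℝ) : E3 :=
  !₂[((starRingEnd ℂ) (w s) * w s - (starRingEnd ℂ) (q s) * q s).re,
    (-2 * (w s * q s * quadPhase s)).re, (-2 * (w s * q s * quadPhase s)).im]

/-- The normal vector built from a spinor. -/
noncomputable def spinorNormal (w q : ℝ → ℂ) (s : ℝ) : E3 :=
  !₂[(2 * ((starRingEnd ℂ) (w s) * q s)).re,
    ((w s ^ 2 - q s ^ 2) * quadPhase s).re, ((w s ^ 2 - q s ^ 2) * quadPhase s).im]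

/-- The binormal vector built from a spinor. -/
noncomputable def spinorBinormal (w q : ℝ → ℂ) (s : ℝ) : E3 :=
  !₂[(2 * ((starRingEnd ℂ) (w s) * q s)).im,
    (I * ((w s ^ 2 + q s ^ 2) * quadPhase s)).re, (I * ((w s ^ 2 + q s ^ 2) * quadPhase s)).im]

/-- The curve built from a spinor. -/
noncomputable def spinorCurve (a : ℝ) (w q : ℝ → ℂ) (s : ℝ) : E3 :=
  s • spinorTangent w q s + (2 * a) • spinorBinormal w q s

namespace IsSpinorSolution

variable {a : ℝ} {w q : ℝ → ℂ}

theorem normSq_add_normSq (h : IsSpinorSolution a w q) (s : ℝ) :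
    (w s).re ^ 2 + (w s).im ^ 2 + ((q s).re ^ 2 + (q s).im ^ 2) = 1 := by
  have hd : ∀ t, HasDerivAt (fun s => (w s).re ^ 2 + (w s).im ^ 2 +
      ((q s).re ^ 2 + (q s).im ^ 2)) 0 t := by
    intro t
    refine ((((h.deriv_w t).complex_re.pow 2).add ((h.deriv_w t).complex_im.pow 2)).add
      (((h.deriv_q t).complex_re.pow 2).add ((h.deriv_q t).complex_im.pow 2))).congr_deriv ?_
    simp
    ring
  have := is_const_of_deriv_eq_zero (fun t => (hd t).differentiableAt)
    (fun t => (hd t).deriv) s 0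
  simpa [h.w_zero, h.q_zero] using this

theorem norm_w_le (h : IsSpinorSolution a w q) (s : ℝ) : ‖w s‖ ≤ 1 := by
  have h1 := h.normSq_add_normSq s
  have h2 := Complex.sq_norm (w s)
  rw [Complex.normSq_apply] at h2
  nlinarith [sq_nonneg (q s).re, sq_nonneg (q s).im, norm_nonneg (w s)]

theorem norm_q_le (h : IsSpinorSolution a w q) (s : ℝ) : ‖q s‖ ≤ 1 := by
  have h1 := h.normSq_add_normSq s
  have h2 := Complex.sq_norm (q s)
  rw [Complex.normSq_apply] at h2
  nlinarith [sq_nonneg (w s).re, sq_nonneg (w s).im, norm_nonneg (q s)]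

theorem spinorTangent_zero_eq (h : IsSpinorSolution a w q) (s : ℝ) :
    spinorTangent w q s 0 = 2 * ‖w s‖ ^ 2 - 1 := by
  have h1 := h.normSq_add_normSq s
  rw [Complex.sq_norm, Complex.normSq_apply]
  simp [spinorTangent]
  linarith

/-- The derivative of `quadPhase` cancels the term `-i (s / 2) q` of `q'` in the product `w q`, so
the torsion does not enter `T'`. -/
theorem hasDerivAt_spinorTangent (h : IsSpinorSolution a w q) (s : ℝ) :
    HasDerivAt (spinorTangent w q) (a • spinorNormal w q s) s := by
  have hw := h.deriv_w s
  have hq := h.deriv_q s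
  have hE := hasDerivAt_quadPhase s
  have h0 := ((hw.complex_conj.mul hw).sub (hq.complex_conj.mul hq)).complex_re
  have hc := ((hw.mul hq).mul hE).const_mul (-2)
  refine (hasDerivAt_vec3 h0 hc.complex_re hc.complex_im).congr_deriv ?_
  ext i
  fin_cases i <;> simp [spinorNormal, pow_two, map_ofNat] <;> ring

theorem hasDerivAt_spinorNormal (h : IsSpinorSolution a w q) (s : ℝ) :
    HasDerivAt (spinorNormal w q)
      (-(a • spinorTangent w q s) + (s / 2) • spinorBinormal w q s) s := by
  have hw := h.deriv_w s
  have hq := h.deriv_q s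
  have hE := hasDerivAt_quadPhase s
  have h0 := ((hw.complex_conj.mul hq).const_mul 2).complex_re
  have hc := ((hw.pow 2).sub (hq.pow 2)).mul hE
  refine (hasDerivAt_vec3 h0 hc.complex_re hc.complex_im).congr_deriv ?_
  ext i
  fin_cases i <;> simp [spinorTangent, spinorBinormal, pow_two, map_ofNat] <;> ring

theorem hasDerivAt_spinorBinormal (h : IsSpinorSolution a w q) (s : ℝ) :
    HasDerivAt (spinorBinormal w q) (-((s / 2) • spinorNormal w q s)) s := by
  have hw := h.deriv_w s
  have hq := h.deriv_q s
  have hE := hasDerivAt_quadPhase s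
  have h0 := ((hw.complex_conj.mul hq).const_mul 2).complex_im
  have hc := (((hw.pow 2).add (hq.pow 2)).mul hE).const_mul I
  refine (hasDerivAt_vec3 h0 hc.complex_re hc.complex_im).congr_deriv ?_
  ext i
  fin_cases i <;> simp [spinorNormal, pow_two, map_ofNat] <;> ring

theorem isFrenetSolution (h : IsSpinorSolution a w q) :
    IsFrenetSolution a (spinorCurve a w q) (spinorTangent w q) (spinorNormal w q)
      (spinorBinormal w q) where
  deriv_G s := by
    refine (((hasDerivAt_id s).smul (h.hasDerivAt_spinorTangent s)).add
      ((h.hasDerivAt_spinorBinormal s).const_smul (2 * a))).congr_deriv ?_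
    simp only [id]
    module
  deriv_T := h.hasDerivAt_spinorTangent
  deriv_n := h.hasDerivAt_spinorNormal
  deriv_b := h.hasDerivAt_spinorBinormal
  G_zero := by
    ext i
    fin_cases i <;>
      simp [spinorCurve, spinorTangent, spinorBinormal, h.w_zero, h.q_zero, quadPhase]
  T_zero := by
    ext i
    fin_cases i <;> simp [spinorTangent, h.w_zero, h.q_zero, quadPhase]
  n_zero := by
    ext i
    fin_cases i <;> simp [spinorNormal, h.w_zero, h.q_zero, quadPhase]
  b_zero := by
    ext i
    fin_cases i <;> simp [spinorBinormal, h.w_zero, h.q_zero, quadPhase]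

theorem norm_spinorBinormal (h : IsSpinorSolution a w q) (s : ℝ) :
    ‖spinorBinormal w q s‖ = 1 := by
  have h1 := h.normSq_add_normSq s
  have h2 := quadPhase_normSq s
  rw [← sq_eq_sq₀ (norm_nonneg _) zero_le_one, EuclideanSpace.norm_sq_eq]
  simp [spinorBinormal, Fin.sum_univ_three, pow_two]
  generalize (w s).re = x at *
  generalize (w s).im = y at *
  generalize (q s).re = z at *
  generalize (q s).im = t at *
  linear_combination (x ^ 2 + y ^ 2 + (z ^ 2 + t ^ 2) + 1) * h1 +
    ((x ^ 2 - y ^ 2 + z ^ 2 - t ^ 2) ^ 2 + (2 * x * y + 2 * z * t) ^ 2) * h2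

theorem norm_spinorCurve_sq (h : IsSpinorSolution a w q) (s : ℝ) :
    ‖spinorCurve a w q s‖ ^ 2 = s ^ 2 + 4 * a ^ 2 := by
  have h1 := h.normSq_add_normSq s
  have h2 := quadPhase_normSq s
  rw [EuclideanSpace.norm_sq_eq]
  simp [spinorCurve, spinorTangent, spinorBinormal, Fin.sum_univ_three, pow_two]
  generalize (w s).re = x at *
  generalize (w s).im = y at *
  generalize (q s).re = z at *
  generalize (q s).im = t at *
  linear_combination (s ^ 2 + 4 * a ^ 2) * (x ^ 2 + y ^ 2 + (z ^ 2 + t ^ 2) + 1) * h1 +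
    ((-2 * s * (x * z - y * t) - 2 * a * (2 * x * y + 2 * z * t)) ^ 2 +
    (-2 * s * (x * t + y * z) + 2 * a * (x ^ 2 - y ^ 2 + z ^ 2 - t ^ 2)) ^ 2) * h2

theorem firstCoord_normSq (h : IsSpinorSolution a w q) (s : ℝ) :
    spinorTangent w q s 0 ^ 2 + spinorNormal w q s 0 ^ 2 + spinorBinormal w q s 0 ^ 2 = 1 := by
  have h1 := h.normSq_add_normSq s
  simp [spinorTangent, spinorNormal, spinorBinormal]
  linear_combination ((w s).re ^ 2 + (w s).im ^ 2 + ((q s).re ^ 2 + (q s).im ^ 2) + 1) * h1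

/-- The first coordinates of `T` and `b` come from `‖w‖ ^ 2 - ‖q‖ ^ 2`, which is even, and `conj w *
q`, which is odd; in the other two coordinates the parities are exchanged. -/
theorem spinorCurve_neg_zero (h : IsSpinorSolution a w q) (s : ℝ) :
    spinorCurve a w q (-s) 0 = -spinorCurve a w q s 0 := by
  simp [spinorCurve, spinorTangent, spinorBinormal, h.w_even, h.q_odd]
  ring

theorem spinorCurve_neg_one (h : IsSpinorSolution a w q) (s : ℝ) :
    spinorCurve a w q (-s) 1 = spinorCurve a w q s 1 := by
  simp [spinorCurve, spinorTangent, spinorBinormal, h.w_even, h.q_odd, quadPhase]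

theorem spinorCurve_neg_two (h : IsSpinorSolution a w q) (s : ℝ) :
    spinorCurve a w q (-s) 2 = spinorCurve a w q s 2 := by
  simp [spinorCurve, spinorTangent, spinorBinormal, h.w_even, h.q_odd, quadPhase]

end IsSpinorSolution

/-- The Frenet matrix is skew-symmetric, so the squared distance between two frames is constant, and
it vanishes at `0`. -/
theorem IsFrenetSolution.unique {a : ℝ} {G T n b G' T' n' b' : ℝ → E3}
    (h : IsFrenetSolution a G T n b) (h' : IsFrenetSolution a G' T' n' b') : G = G' := by
  have hT : T = T' := by
    have hd : ∀ s, HasDerivAt (fun s => ‖T s - T' s‖ ^ 2 + ‖n s - n' s‖ ^ 2 + ‖b s - b' s‖ ^ 2)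
        0 s := by
      intro s
      refine ((((h.deriv_T s).sub (h'.deriv_T s)).norm_sq.add
        ((h.deriv_n s).sub (h'.deriv_n s)).norm_sq).add
        ((h.deriv_b s).sub (h'.deriv_b s)).norm_sq).congr_deriv ?_
      rw [show a • n s - a • n' s = a • (n s - n' s) by module,
        show -(a • T s) + (s / 2) • b s - (-(a • T' s) + (s / 2) • b' s) =
          -(a • (T s - T' s)) + (s / 2) • (b s - b' s) by module,
        show -((s / 2) • n s) - -((s / 2) • n' s) = -((s / 2) • (n s - n' s)) by module]
      simp only [Pi.sub_apply, inner_add_right, inner_neg_right, inner_smul_right]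
      rw [real_inner_comm (T s - T' s) (n s - n' s), real_inner_comm (n s - n' s) (b s - b' s)]
      ring
    funext s
    have := is_const_of_deriv_eq_zero (fun t => (hd t).differentiableAt)
      (fun t => (hd t).deriv) s 0
    simp only [h.T_zero, h'.T_zero, h.n_zero, h'.n_zero, h.b_zero, h'.b_zero, sub_self,
      norm_zero] at this
    have h0 : ‖T s - T' s‖ ^ 2 = 0 := by
      nlinarith [sq_nonneg ‖T s - T' s‖, sq_nonneg ‖n s - n' s‖, sq_nonneg ‖b s - b' s‖]
    exact sub_eq_zero.mp (norm_eq_zero.mp (pow_eq_zero_iff two_ne_zero |>.mp h0))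
  subst hT
  have hd : ∀ s, HasDerivAt (fun s => G s - G' s) 0 s := fun s =>
    ((h.deriv_G s).sub (h'.deriv_G s)).congr_deriv (sub_self _)
  funext s
  have := is_const_of_deriv_eq_zero (fun t => (hd t).differentiableAt)
    (fun t => (hd t).deriv) s 0
  simp only [h.G_zero, h'.G_zero, sub_self] at this
  exact sub_eq_zero.mp this

theorem IsSpinorSolution.profile_eq {a : ℝ} {w q : ℝ → ℂ} (h : IsSpinorSolution a w q) :
    profile a = spinorCurve a w q := by
  have h1 : IsProfile a (spinorCurve a w q) := ⟨_, _, _, h.isFrenetSolution⟩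
  obtain ⟨T, n, b, h2⟩ : IsProfile a (profile a) := Classical.epsilon_spec ⟨_, h1⟩
  exact h2.unique h.isFrenetSolution

theorem isProfile_profile (a : ℝ) : IsProfile a (profile a) := by
  obtain ⟨w, q, h⟩ := exists_isSpinorSolution a
  exact Classical.epsilon_spec ⟨_, _, _, _, h.isFrenetSolution⟩

theorem IsProfile.eq_profile {a : ℝ} {G : ℝ → E3} (h : IsProfile a G) : G = profile a := by
  obtain ⟨T, n, b, h⟩ := h
  obtain ⟨T', n', b', h'⟩ := isProfile_profile a
  exact h.unique h'

/-! ### Gaussian integrals and the modulus of Gamma -/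

theorem integrable_exp_neg_sq : Integrable fun r : ℝ => Real.exp (-r ^ 2) := by
  simpa using integrable_exp_neg_mul_sq one_pos

theorem integrable_mul_exp_neg_sq : Integrable fun r : ℝ => r * Real.exp (-r ^ 2) := by
  simpa using integrable_mul_exp_neg_mul_sq one_pos

theorem hasDerivAt_exp_neg_sq (r : ℝ) :
    HasDerivAt (fun r : ℝ => (Real.exp (-r ^ 2) : ℂ)) (-2 * r * (Real.exp (-r ^ 2) : ℂ)) r := by
  have h : HasDerivAt (fun r : ℝ => Real.exp (-r ^ 2)) (Real.exp (-r ^ 2) * (-(2 * r))) r := by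
    simpa using ((hasDerivAt_pow 2 r).neg).exp
  refine h.ofReal_comp.congr_deriv ?_
  push_cast
  ring

/-- Euler's integral for Gamma after the substitution `x = r ^ 2`. -/
theorem integral_exp_neg_sq_mul_log_phase (t : ℝ) :
    ∫ r in Ioi (0 : ℝ), (Real.exp (-r ^ 2) : ℂ) * cexp (2 * t * Real.log r * I) =
      Complex.Gamma (1 / 2 + t * I) / 2 := by
  rw [Complex.Gamma_eq_integral (by simp), Complex.GammaIntegral,
    ← integral_comp_rpow_Ioi_of_pos
      (g := fun x : ℝ => (Real.exp (-x) : ℂ) * (x : ℂ) ^ (1 / 2 + t * I - 1)) two_pos, ← integral_div]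
  refine setIntegral_congr_fun measurableSet_Ioi fun r hr => ?_
  have hr : 0 < r := hr
  have hr' : (r : ℂ) ≠ 0 := by exact_mod_cast hr.ne'
  have h1 : (((r ^ (2 : ℝ) : ℝ) : ℂ)) ^ (1 / 2 + t * I - 1) =
      (r : ℂ)⁻¹ * cexp (2 * t * Real.log r * I) := by
    rw [Complex.cpow_def_of_ne_zero (by exact_mod_cast (Real.rpow_pos_of_pos hr 2).ne'),
      ← Complex.ofReal_log (Real.rpow_pos_of_pos hr 2).le, Real.log_rpow hr]
    have : (r : ℂ)⁻¹ = cexp (-Real.log r) := by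
      rw [Complex.exp_neg, ← Complex.ofReal_exp, Real.exp_log hr]
    rw [this, ← Complex.exp_add]
    congr 1
    push_cast
    ring
  rw [h1, Complex.real_smul, Real.rpow_two]
  norm_num
  field_simp

/-- The reflection formula on the line of real part `1 / 2`, where `1 - z` is the conjugate of `z`.
-/
theorem norm_Gamma_half_add_sq (t : ℝ) :
    ‖Complex.Gamma (1 / 2 + t * I)‖ ^ 2 * Real.cosh (Real.pi * t) = Real.pi := by
  have h1 := Complex.Gamma_mul_Gamma_one_sub (1 / 2 + t * I)
  have h2 : (1 - (1 / 2 + t * I) : ℂ) = (starRingEnd ℂ) (1 / 2 + t * I) := by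
    simp [map_ofNat]
    ring
  have h3 : Complex.sin (Real.pi * (1 / 2 + t * I)) = ((Real.cosh (Real.pi * t) : ℝ) : ℂ) := by
    rw [show (Real.pi * (1 / 2 + t * I) : ℂ) = (Real.pi * t : ℂ) * I + Real.pi / 2 by ring,
      Complex.sin_add_pi_div_two, Complex.cos_mul_I]
    push_cast
    rfl
  rw [h2, Complex.Gamma_conj, Complex.mul_conj, h3, Complex.normSq_eq_norm_sq] at h1
  have h4 := (Real.cosh_pos (Real.pi * t)).ne'
  have h5 : ‖Complex.Gamma (1 / 2 + t * I)‖ ^ 2 = Real.pi / Real.cosh (Real.pi * t) := by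
    exact_mod_cast h1
  rw [h5, div_mul_cancel₀ _ h4]

theorem tendsto_arg_one_add_mul_I :
    Tendsto (fun y : ℝ => arg (1 + y * I)) atTop (𝓝 (Real.pi / 2)) := by
  have h1 : Tendsto (fun y : ℝ => ((y⁻¹ : ℝ) : ℂ) + I) atTop (𝓝 I) := by
    have := (Complex.continuous_ofReal.tendsto 0).comp tendsto_inv_atTop_zero
    simpa using this.add_const I
  have h2 := (continuousAt_arg (x := I) (by simp [mem_slitPlane_iff])).tendsto.comp h1
  rw [arg_I] at h2
  refine h2.congr' ?_
  filter_upwards [eventually_gt_atTop 0] with y hy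
  have hy' : (y : ℂ) ≠ 0 := by exact_mod_cast hy.ne'
  rw [show (1 + y * I : ℂ) = y * (((y⁻¹ : ℝ) : ℂ) + I) by push_cast; field_simp,
    arg_real_mul _ hy]
  rfl

/-! ### The modulus of the spinor at infinity -/

namespace IsSpinorSolution

variable {a : ℝ} {w q : ℝ → ℂ}

theorem continuous_w (h : IsSpinorSolution a w q) : Continuous w :=
  continuous_iff_continuousAt.mpr fun s => (h.deriv_w s).continuousAt

theorem continuous_q (h : IsSpinorSolution a w q) : Continuous q :=
  continuous_iff_continuousAt.mpr fun s => (h.deriv_q s).continuousAt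

/-- Up to a logarithmic phase, the even spinor component converges at infinity. -/
theorem exists_tendsto_phase_mul (h : IsSpinorSolution a w q) :
    ∃ c : ℂ, Tendsto (fun s : ℝ => cexp (-(a ^ 2 / 2 * Real.log s * I)) * w s) atTop (𝓝 c) := by
  set φ : ℝ → ℂ := fun s => cexp (-(a ^ 2 / 2 * Real.log s * I)) with hφ
  have nφ : ∀ s, ‖φ s‖ = 1 := fun s => by
    rw [hφ]
    simp only []
    rw [show -((a : ℂ) ^ 2 / 2 * Real.log s * I) = ((-(a ^ 2 / 2 * Real.log s) : ℝ) : ℂ) * I by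
      push_cast; ring]
    exact norm_exp_ofReal_mul_I _
  have dφ : ∀ s : ℝ, 0 < s → HasDerivAt φ (-(a ^ 2 / 2 * (s : ℂ)⁻¹ * I) * φ s) s := by
    intro s hs
    have h1 := ((((Real.hasDerivAt_log hs.ne').ofReal_comp).const_mul
      ((a : ℂ) ^ 2 / 2)).mul_const I).neg.cexp
    refine h1.congr_deriv ?_
    simp only [hφ, Pi.neg_apply]
    push_cast
    ring
  -- The equation for `q` gives `w' = (i a / s) q' + i (a ^ 2 / (2 s)) w`. The phase removes the
  -- last term and the correction `-i a q / s` removes the `q'` term, leaving an integrable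
  -- remainder of order `s ^ (-2)`.
  have dH : ∀ s ∈ Ioi (1 : ℝ), HasDerivAt (fun s : ℝ => φ s * (w s - I * a * (q s * (s : ℂ)⁻¹)))
      (φ s * (q s * ((s ^ (-2 : ℝ) : ℝ) : ℂ)) * (-(a ^ 3 / 2) + I * a)) s := by
    intro s hs
    have hs0 : 0 < s := one_pos.trans hs
    have hsc : (s : ℂ) ≠ 0 := by exact_mod_cast hs0.ne'
    have hi : HasDerivAt (fun s : ℝ => (s : ℂ)⁻¹) (-((s : ℂ) ^ 2)⁻¹) s := by
      have := (hasDerivAt_inv hs0.ne').ofReal_comp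
      push_cast at this
      exact this
    have h1 := (dφ s hs0).mul ((h.deriv_w s).sub (((h.deriv_q s).mul hi).const_mul (I * a)))
    refine h1.congr_deriv ?_
    have h2 : ((s ^ (-2 : ℝ) : ℝ) : ℂ) = ((s : ℂ) ^ 2)⁻¹ := by
      rw [Real.rpow_neg hs0.le, Real.rpow_two]
      push_cast
      rfl
    rw [h2]
    simp only [Pi.sub_apply, Pi.mul_apply]
    field_simp
    ring_nf
    simp only [Complex.I_sq]
    ring
  have cφ : ContinuousOn φ (Ioi 1) := fun s hs =>
    (dφ s (one_pos.trans hs)).continuousAt.continuousWithinAt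
  have hint : IntegrableOn
      (fun s : ℝ => φ s * (q s * ((s ^ (-2 : ℝ) : ℝ) : ℂ)) * (-(a ^ 3 / 2) + I * a)) (Ioi 1) := by
    refine Integrable.mul_const ?_ _
    have h0 := integrableOn_Ioi_rpow_of_lt (a := -2) (by norm_num) one_pos
    refine Integrable.mono' h0 ?_ ?_
    · refine ContinuousOn.aestronglyMeasurable ?_ measurableSet_Ioi
      refine cφ.mul (h.continuous_q.continuousOn.mul
        (Complex.continuous_ofReal.comp_continuousOn ?_))
      exact ContinuousOn.rpow_const continuousOn_id
        fun s hs => Or.inl (one_pos.trans (show (1 : ℝ) < s from hs)).ne'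
    · refine (ae_restrict_iff' measurableSet_Ioi).mpr (Eventually.of_forall fun s hs => ?_)
      have hs0 : 0 < s := one_pos.trans hs
      have h3 := Real.rpow_nonneg hs0.le (-2)
      rw [norm_mul, norm_mul, nφ, one_mul, Complex.norm_real, Real.norm_of_nonneg h3]
      exact mul_le_of_le_one_left h3 (h.norm_q_le s)
  have hlim := tendsto_limUnder_of_hasDerivAt_of_integrableOn_Ioi dH hint
  refine ⟨_, (hlim.add (?_ : Tendsto (fun s : ℝ => φ s * (I * a * (q s * (s : ℂ)⁻¹))) atTop
    (𝓝 0))).congr fun s => ?_⟩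
  · rw [tendsto_zero_iff_norm_tendsto_zero]
    refine squeeze_zero' (g := fun s => |a| * s⁻¹) (Eventually.of_forall fun s => norm_nonneg _)
      ?_ (by simpa using tendsto_inv_atTop_zero.const_mul |a|)
    filter_upwards [eventually_gt_atTop 0] with s hs
    have := h.norm_q_le s
    rw [norm_mul, nφ, one_mul, norm_mul, norm_mul, norm_I, one_mul, Complex.norm_real, norm_mul,
      norm_inv, Complex.norm_real, Real.norm_eq_abs, Real.norm_of_nonneg hs.le]
    have h3 : 0 < s⁻¹ := inv_pos.mpr hs
    gcongr
    exact mul_le_of_le_one_left h3.le this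
  · ring

/-- The Gaussian average of the even spinor component is differentiable in the scale `x`. -/
theorem hasDerivAt_gaussianAverage (h : IsSpinorSolution a w q) (x : ℝ) :
    HasDerivAt (fun x : ℝ => ∫ r in Ioi (0 : ℝ), (Real.exp (-r ^ 2) : ℂ) * w (x * r))
      (a / 2 * ∫ r in Ioi (0 : ℝ), (Real.exp (-r ^ 2) : ℂ) * (r * q (x * r))) x := by
  have cw := h.continuous_w
  have cq := h.continuous_q
  have key := hasDerivAt_integral_of_dominated_loc_of_deriv_le (μ := volume.restrict (Ioi (0 : ℝ)))
    (F := fun (x r : ℝ) => (Real.exp (-r ^ 2) : ℂ) * w (x * r))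
    (F' := fun (x r : ℝ) => (Real.exp (-r ^ 2) : ℂ) * (r * (a / 2 * q (x * r))))
    (bound := fun r => |a| / 2 * (r * Real.exp (-r ^ 2))) (x₀ := x) (s := univ) univ_mem
    (Eventually.of_forall fun y => (by fun_prop : Continuous fun r : ℝ =>
      (Real.exp (-r ^ 2) : ℂ) * w (y * r)).aestronglyMeasurable)
    ?_ (by fun_prop : Continuous fun r : ℝ =>
      (Real.exp (-r ^ 2) : ℂ) * (r * (a / 2 * q (x * r)))).aestronglyMeasurable
    ?_ (integrable_mul_exp_neg_sq.const_mul _).integrableOn ?_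
  · refine key.2.congr_deriv ?_
    rw [← integral_const_mul]
    congr 1
    funext r
    ring
  · refine Integrable.mono' integrable_exp_neg_sq.integrableOn
      (by fun_prop : Continuous fun r : ℝ =>
        (Real.exp (-r ^ 2) : ℂ) * w (x * r)).aestronglyMeasurable (Eventually.of_forall fun r => ?_)
    rw [norm_mul, Complex.norm_real, Real.norm_of_nonneg (Real.exp_pos _).le]
    exact mul_le_of_le_one_right (Real.exp_pos _).le (h.norm_w_le _)
  · refine (ae_restrict_iff' measurableSet_Ioi).mpr (Eventually.of_forall fun r hr y _ => ?_)
    have hr : 0 < r := hr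
    have hq := h.norm_q_le (y * r)
    rw [norm_mul, norm_mul, norm_mul, norm_div, Complex.norm_real, Complex.norm_real,
      Complex.norm_real, Real.norm_of_nonneg (Real.exp_pos _).le, Real.norm_of_nonneg hr.le,
      Real.norm_eq_abs, Complex.norm_ofNat]
    calc _ ≤ Real.exp (-r ^ 2) * (r * (|a| / 2 * 1)) := by gcongr
      _ = _ := by ring
  · refine Eventually.of_forall fun r y _ => ?_
    have h1 : HasDerivAt (fun y : ℝ => y * r) r y := by simpa using (hasDerivAt_id y).mul_const r
    refine (((h.deriv_w (y * r)).scomp y h1).const_mul _).congr_deriv ?_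
    rw [Complex.real_smul]

/-- Integrating the derivative of `exp (-r ^ 2) q (x r)` over the half-line gives zero, as `q 0 = 0`
and `q` is bounded. This expresses the first moment of `q` through the average of `w` and closes the
equation in `x`. -/
theorem gaussianAverage_relation (h : IsSpinorSolution a w q) (x : ℝ) :
    (1 + I * x ^ 2 / 4) * (a / 2 * ∫ r in Ioi (0 : ℝ), (Real.exp (-r ^ 2) : ℂ) * (r * q (x * r))) =
      -(a ^ 2 / 8 * x) * ∫ r in Ioi (0 : ℝ), (Real.exp (-r ^ 2) : ℂ) * w (x * r) := by
  have cw := h.continuous_w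
  have cq := h.continuous_q
  have i1 : IntegrableOn (fun r : ℝ => (Real.exp (-r ^ 2) : ℂ) * w (x * r)) (Ioi 0) := by
    refine Integrable.mono' integrable_exp_neg_sq.integrableOn
      (by fun_prop : Continuous fun r : ℝ =>
        (Real.exp (-r ^ 2) : ℂ) * w (x * r)).aestronglyMeasurable (Eventually.of_forall fun r => ?_)
    rw [norm_mul, Complex.norm_real, Real.norm_of_nonneg (Real.exp_pos _).le]
    exact mul_le_of_le_one_right (Real.exp_pos _).le (h.norm_w_le _)
  have i2 : IntegrableOn (fun r : ℝ => (Real.exp (-r ^ 2) : ℂ) * (r * q (x * r))) (Ioi 0) := by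
    refine Integrable.mono' integrable_mul_exp_neg_sq.integrableOn
      (by fun_prop : Continuous fun r : ℝ =>
        (Real.exp (-r ^ 2) : ℂ) * (r * q (x * r))).aestronglyMeasurable
      ((ae_restrict_iff' measurableSet_Ioi).mpr (Eventually.of_forall fun r hr => ?_))
    have hr : 0 < r := hr
    have hq := h.norm_q_le (x * r)
    rw [norm_mul, norm_mul, Complex.norm_real, Complex.norm_real,
      Real.norm_of_nonneg (Real.exp_pos _).le, Real.norm_of_nonneg hr.le]
    calc _ ≤ Real.exp (-r ^ 2) * (r * 1) := by gcongr
      _ = _ := by ring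
  have dF : ∀ r ∈ Ici (0 : ℝ), HasDerivAt (fun r : ℝ => (Real.exp (-r ^ 2) : ℂ) * q (x * r))
      (-(2 + I * x ^ 2 / 2) * ((Real.exp (-r ^ 2) : ℂ) * (r * q (x * r))) +
        -(a / 2 * x) * ((Real.exp (-r ^ 2) : ℂ) * w (x * r))) r := by
    intro r _
    have h1 : HasDerivAt (fun r : ℝ => x * r) x r := by simpa using (hasDerivAt_id r).const_mul x
    refine ((hasDerivAt_exp_neg_sq r).mul ((h.deriv_q (x * r)).scomp r h1)).congr_deriv ?_
    simp only [Complex.real_smul, Function.comp]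
    push_cast
    ring
  have hlim : Tendsto (fun r : ℝ => (Real.exp (-r ^ 2) : ℂ) * q (x * r)) atTop (𝓝 0) := by
    rw [tendsto_zero_iff_norm_tendsto_zero]
    refine squeeze_zero (g := fun r => Real.exp (-r ^ 2)) (fun r => norm_nonneg _) (fun r => ?_)
      (Real.tendsto_exp_neg_atTop_nhds_zero.comp (tendsto_pow_atTop two_ne_zero))
    rw [norm_mul, Complex.norm_real, Real.norm_of_nonneg (Real.exp_pos _).le]
    exact mul_le_of_le_one_right (Real.exp_pos _).le (h.norm_q_le _)
  have key := integral_Ioi_of_hasDerivAt_of_tendsto' dF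
    ((i2.const_mul _).add (i1.const_mul _)) hlim
  rw [integral_add (i2.const_mul _) (i1.const_mul _), integral_const_mul, integral_const_mul,
    mul_zero, h.q_zero, mul_zero, sub_zero] at key
  linear_combination -(a / 4 : ℂ) * key

/-- The average `S` satisfies `(1 + i x ^ 2 / 4) S' = -(a ^ 2 / 8) x S`, and the exponential is the
integrating factor. The constant is the Gaussian integral, read off at `x = 0`. -/
theorem gaussianAverage_eq (h : IsSpinorSolution a w q) (x : ℝ) :
    cexp (-(I * (a ^ 2 / 4) * Complex.log (1 + (x ^ 2 / 4 : ℝ) * I))) *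
      ∫ r in Ioi (0 : ℝ), (Real.exp (-r ^ 2) : ℂ) * w (x * r) = (√Real.pi / 2 : ℝ) := by
  have hd : ∀ x : ℝ, HasDerivAt
      (fun x : ℝ => cexp (-(I * (a ^ 2 / 4) * Complex.log (1 + (x ^ 2 / 4 : ℝ) * I))) *
        ∫ r in Ioi (0 : ℝ), (Real.exp (-r ^ 2) : ℂ) * w (x * r)) 0 x := by
    intro x
    have hs : (1 + (x ^ 2 / 4 : ℝ) * I) ∈ slitPlane := by
      rw [mem_slitPlane_iff]
      left
      rw [add_re, re_ofReal_mul]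
      simp
    have hne : (1 + (x ^ 2 / 4 : ℝ) * I) ≠ 0 := slitPlane_ne_zero hs
    have h1 : HasDerivAt (fun x : ℝ => (1 + (x ^ 2 / 4 : ℝ) * I)) (x / 2 * I) x := by
      have := (((hasDerivAt_pow 2 x).div_const 4).ofReal_comp.mul_const I).const_add 1
      refine this.congr_deriv ?_
      push_cast
      ring
    have h2 := ((h1.clog_real hs).const_mul (I * ((a : ℂ) ^ 2 / 4))).neg.cexp
    refine (h2.mul (h.hasDerivAt_gaussianAverage x)).congr_deriv ?_
    have h3 := h.gaussianAverage_relation x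
    have h4 : (1 + I * x ^ 2 / 4 : ℂ) = 1 + (x ^ 2 / 4 : ℝ) * I := by push_cast; ring
    rw [h4] at h3
    generalize (1 + (x ^ 2 / 4 : ℝ) * I : ℂ) = z at *
    generalize (∫ r in Ioi (0 : ℝ), (Real.exp (-r ^ 2) : ℂ) * w (x * r)) = S at *
    generalize (∫ r in Ioi (0 : ℝ), (Real.exp (-r ^ 2) : ℂ) * (r * q (x * r))) = N at *
    have h5 : (a / 2 * N : ℂ) = -(a ^ 2 / 8 * x) * S / z := by
      rw [eq_div_iff hne, ← h3]; ring
    rw [h5]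
    field_simp
    ring_nf
    simp only [Complex.I_sq]
    ring
  have h1 := is_const_of_deriv_eq_zero (fun t => (hd t).differentiableAt)
    (fun t => (hd t).deriv) x 0
  rw [h1]
  have h2 := integral_gaussian_Ioi 1
  simp only [neg_mul, one_mul, div_one] at h2
  have h3 : ∫ r in Ioi (0 : ℝ), (Real.exp (-r ^ 2) : ℂ) * w (0 * r) = (√Real.pi / 2 : ℝ) := by
    rw [← h2, ← integral_complex_ofReal]
    simp [h.w_zero]
  rw [h3]
  simp

/-- The modulus of the even spinor component at infinity. -/
theorem tendsto_norm_w_sq (h : IsSpinorSolution a w q) :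
    Tendsto (fun s => ‖w s‖ ^ 2) atTop (𝓝 ((1 + Real.exp (-(Real.pi * a ^ 2 / 2))) / 2)) := by
  obtain ⟨c, hc⟩ := h.exists_tendsto_phase_mul
  have cw := h.continuous_w
  have nphase : ∀ t : ℝ, ‖cexp (-(a ^ 2 / 2 * t * I))‖ = 1 := fun t => by
    rw [show -((a : ℂ) ^ 2 / 2 * t * I) = ((-(a ^ 2 / 2 * t) : ℝ) : ℂ) * I by push_cast; ring]
    exact norm_exp_ofReal_mul_I _
  have hw : Tendsto (fun s => ‖w s‖) atTop (𝓝 ‖c‖) := by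
    refine hc.norm.congr fun s => ?_
    rw [norm_mul, nphase, one_mul]
  -- Since `log (x r) = log x + log r`, the phase at `x` differs from that at `x r` by `r ^ (i a ^ 2
  -- / 2)`; dominated convergence leaves `c` times a Gamma integral.
  have hS : Tendsto (fun x : ℝ => cexp (-(a ^ 2 / 2 * Real.log x * I)) *
      ∫ r in Ioi (0 : ℝ), (Real.exp (-r ^ 2) : ℂ) * w (x * r)) atTop
      (𝓝 (c * (Complex.Gamma (1 / 2 + (a ^ 2 / 4 : ℝ) * I) / 2))) := by
    rw [← integral_exp_neg_sq_mul_log_phase, ← integral_const_mul]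
    simp_rw [← integral_const_mul]
    refine tendsto_integral_filter_of_dominated_convergence (fun r => Real.exp (-r ^ 2))
      (Eventually.of_forall fun x => (by fun_prop : Continuous fun r : ℝ =>
        cexp (-(a ^ 2 / 2 * Real.log x * I)) *
          ((Real.exp (-r ^ 2) : ℂ) * w (x * r))).aestronglyMeasurable)
      (Eventually.of_forall fun x => Eventually.of_forall fun r => ?_)
      integrable_exp_neg_sq.integrableOn
      ((ae_restrict_iff' measurableSet_Ioi).mpr (Eventually.of_forall fun r hr => ?_))
    · rw [norm_mul, nphase, one_mul, norm_mul, Complex.norm_real,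
        Real.norm_of_nonneg (Real.exp_pos _).le]
      exact mul_le_of_le_one_right (Real.exp_pos _).le (h.norm_w_le _)
    · have hr : 0 < r := hr
      refine ((hc.comp (tendsto_id.atTop_mul_const hr)).mul_const
        ((Real.exp (-r ^ 2) : ℂ) * cexp (2 * (a ^ 2 / 4 : ℝ) * Real.log r * I))).congr' ?_
      filter_upwards [eventually_gt_atTop 0] with x hx
      simp only [Function.comp, id]
      rw [Real.log_mul hx.ne' hr.ne',
        show (-((a : ℂ) ^ 2 / 2 * Real.log x * I)) =
          -((a : ℂ) ^ 2 / 2 * ((Real.log x + Real.log r : ℝ) : ℂ) * I) +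
            2 * (a ^ 2 / 4 : ℝ) * Real.log r * I by push_cast; ring, Complex.exp_add]
      ring
  have hA : Tendsto (fun x : ℝ => Real.exp (a ^ 2 / 4 * arg (1 + (x ^ 2 / 4 : ℝ) * I))) atTop
      (𝓝 (Real.exp (a ^ 2 / 4 * (Real.pi / 2)))) :=
    (Real.continuous_exp.tendsto _).comp ((tendsto_arg_one_add_mul_I.comp
      ((tendsto_pow_atTop two_ne_zero).atTop_div_const (by norm_num : (0 : ℝ) < 4))).const_mul _)
  -- The modulus of the integrating factor comes only from the argument of `1 + i x ^ 2 / 4`, which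
  -- tends to `π / 2`.
  have hprod : ∀ x : ℝ, Real.exp (a ^ 2 / 4 * arg (1 + (x ^ 2 / 4 : ℝ) * I)) *
      ‖cexp (-(a ^ 2 / 2 * Real.log x * I)) *
        ∫ r in Ioi (0 : ℝ), (Real.exp (-r ^ 2) : ℂ) * w (x * r)‖ = √Real.pi / 2 := by
    intro x
    have h1 := congrArg norm (h.gaussianAverage_eq x)
    rw [norm_mul, Complex.norm_exp, Complex.norm_real, Real.norm_of_nonneg (by positivity)] at h1
    rw [norm_mul, nphase, one_mul, ← h1]
    congr 2
    rw [show (I * ((a : ℂ) ^ 2 / 4) * Complex.log (1 + (x ^ 2 / 4 : ℝ) * I)) =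
      ((a ^ 2 / 4 : ℝ) : ℂ) * (I * Complex.log (1 + (x ^ 2 / 4 : ℝ) * I)) by push_cast; ring,
      neg_re, re_ofReal_mul, I_mul_re, Complex.log_im]
    ring
  have hlim := tendsto_nhds_unique ((hA.mul hS.norm).congr hprod) tendsto_const_nhds
  have hΓ := norm_Gamma_half_add_sq (a ^ 2 / 4)
  rw [norm_mul, norm_div, Complex.norm_ofNat] at hlim
  set g := ‖Complex.Gamma (1 / 2 + (a ^ 2 / 4 : ℝ) * I)‖ with hg
  have hcosh := Real.cosh_pos (Real.pi * (a ^ 2 / 4))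
  have hg2 : g ^ 2 = Real.pi / Real.cosh (Real.pi * (a ^ 2 / 4)) := by
    rw [eq_div_iff hcosh.ne', hΓ]
  have h2 : Real.exp (a ^ 2 / 4 * (Real.pi / 2)) ^ 2 * (‖c‖ ^ 2 * g ^ 2) = Real.pi := by
    have h3 : Real.exp (a ^ 2 / 4 * (Real.pi / 2)) * (‖c‖ * g) = √Real.pi := by linarith
    rw [← mul_pow, ← mul_pow, h3, Real.sq_sqrt Real.pi_pos.le]
  rw [hg2, ← Real.exp_nat_mul] at h2
  have h3 : Real.exp ((2 : ℕ) * (a ^ 2 / 4 * (Real.pi / 2))) * ‖c‖ ^ 2 =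
      Real.cosh (Real.pi * (a ^ 2 / 4)) := by
    rw [← mul_assoc, mul_div_assoc', div_eq_iff hcosh.ne', mul_comm Real.pi] at h2
    exact mul_right_cancel₀ Real.pi_pos.ne' h2
  have h4 : ‖c‖ ^ 2 = (1 + Real.exp (-(Real.pi * a ^ 2 / 2))) / 2 := by
    have h5 : Real.exp ((2 : ℕ) * (a ^ 2 / 4 * (Real.pi / 2))) = Real.exp (Real.pi * (a ^ 2 / 4)) := by
      congr 1
      push_cast
      ring
    rw [h5] at h3
    have h6 : Real.exp (-(Real.pi * a ^ 2 / 2)) * Real.exp (Real.pi * (a ^ 2 / 4)) =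
        Real.exp (-(Real.pi * (a ^ 2 / 4))) := by
      rw [← Real.exp_add]
      congr 1
      ring
    rw [Real.cosh_eq] at h3
    refine mul_left_cancel₀ (Real.exp_pos (Real.pi * (a ^ 2 / 4))).ne' ?_
    linarith
  rw [← h4]
  exact hw.pow 2

end IsSpinorSolution

/-! ### Limit directions and the first coordinate of the curve -/

theorem le_of_hasDerivAt_nonneg {f f' : ℝ → ℝ} {u v : ℝ} (huv : u ≤ v)
    (hd : ∀ t ∈ Icc u v, HasDerivAt f (f' t) t) (h0 : ∀ t ∈ Icc u v, 0 ≤ f' t) : f u ≤ f v := by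
  refine monotoneOn_of_deriv_nonneg (convex_Icc u v)
    (fun t ht => (hd t ht).continuousAt.continuousWithinAt)
    (fun t ht => (hd t (interior_subset ht)).differentiableAt.differentiableWithinAt)
    (fun t ht => ?_) (left_mem_Icc.mpr huv) (right_mem_Icc.mpr huv) huv
  rw [(hd t (interior_subset ht)).deriv]
  exact h0 t (interior_subset ht)

theorem abs_le_sq_of_abs_deriv_le {f f' : ℝ → ℝ} {s : ℝ} (hs : 0 ≤ s) (h0 : f 0 = 0)
    (hd : ∀ t, HasDerivAt f (f' t) t) (hb : ∀ t, 0 ≤ t → |f' t| ≤ t / 2) : |f s| ≤ s ^ 2 / 4 := by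
  have hsq : ∀ t : ℝ, HasDerivAt (fun t : ℝ => t ^ 2 / 4) (t / 2) t := fun t =>
    ((hasDerivAt_pow 2 t).div_const 4).congr_deriv (by push_cast; ring)
  have h1 := le_of_hasDerivAt_nonneg hs (fun t _ => (hsq t).sub (hd t)) fun t ht => by
    have := (abs_le.mp (hb t ht.1)).2
    linarith
  have h2 := le_of_hasDerivAt_nonneg hs (fun t _ => (hsq t).add (hd t)) fun t ht => by
    have := (abs_le.mp (hb t ht.1)).1
    linarith
  simp only [Pi.sub_apply, Pi.add_apply, h0] at h1 h2
  rw [abs_le]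
  constructor <;> linarith

namespace IsSpinorSolution

variable {a : ℝ} {w q : ℝ → ℂ}

theorem hasDerivAt_curve_zero (h : IsSpinorSolution a w q) (s : ℝ) :
    HasDerivAt (fun s => spinorCurve a w q s 0) (spinorTangent w q s 0) s :=
  (h.isFrenetSolution.deriv_G s).coord 0

theorem hasDerivAt_tangent_zero (h : IsSpinorSolution a w q) (s : ℝ) :
    HasDerivAt (fun s => spinorTangent w q s 0) (a * spinorNormal w q s 0) s :=
  ((h.hasDerivAt_spinorTangent s).coord 0).congr_deriv (by simp)

theorem hasDerivAt_normal_zero (h : IsSpinorSolution a w q) (s : ℝ) :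
    HasDerivAt (fun s => spinorNormal w q s 0)
      (-(a * spinorTangent w q s 0) + s / 2 * spinorBinormal w q s 0) s :=
  ((h.hasDerivAt_spinorNormal s).coord 0).congr_deriv (by simp)

theorem curve_zero_eq (s : ℝ) :
    spinorCurve a w q s 0 = s * spinorTangent w q s 0 + 2 * a * spinorBinormal w q s 0 := by
  simp [spinorCurve]

theorem abs_normal_zero_le (h : IsSpinorSolution a w q) (s : ℝ) :
    |spinorNormal w q s 0| ≤ 1 := by
  rw [← sq_le_one_iff_abs_le_one]
  have := h.firstCoord_normSq s
  nlinarith [sq_nonneg (spinorTangent w q s 0), sq_nonneg (spinorBinormal w q s 0)]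

theorem abs_binormal_zero_le (h : IsSpinorSolution a w q) (s : ℝ) :
    |spinorBinormal w q s 0| ≤ 1 := by
  rw [← sq_le_one_iff_abs_le_one]
  have := h.firstCoord_normSq s
  nlinarith [sq_nonneg (spinorTangent w q s 0), sq_nonneg (spinorNormal w q s 0)]

theorem tangent_zero_at_zero (h : IsSpinorSolution a w q) : spinorTangent w q 0 0 = 1 := by
  rw [h.isFrenetSolution.T_zero]; simp

theorem normal_zero_at_zero (h : IsSpinorSolution a w q) : spinorNormal w q 0 0 = 0 := by
  rw [h.isFrenetSolution.n_zero]; simp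

theorem curve_zero_at_zero (h : IsSpinorSolution a w q) : spinorCurve a w q 0 0 = 0 := by
  rw [h.isFrenetSolution.G_zero]; simp

theorem spinorCurve_neg (h : IsSpinorSolution a w q) (s : ℝ) :
    spinorCurve a w q (-s) =
      spinorCurve a w q s - (2 * spinorCurve a w q s 0) • (!₂[1, 0, 0] : E3) := by
  ext i
  fin_cases i
  · simp [h.spinorCurve_neg_zero]; ring
  · simp [h.spinorCurve_neg_one]
  · simp [h.spinorCurve_neg_two]

/-- The derivative of `G / s` is `(s T - G) / s ^ 2 = -2 a b / s ^ 2`, which is integrable at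
infinity because `b` is a unit vector. -/
theorem tendsto_inv_smul_atTop (h : IsSpinorSolution a w q) :
    Tendsto (fun s : ℝ => s⁻¹ • spinorCurve a w q s) atTop
      (𝓝 (limUnder atTop fun s : ℝ => s⁻¹ • spinorCurve a w q s)) := by
  have hcb : Continuous (spinorBinormal w q) :=
    continuous_iff_continuousAt.mpr fun s => (h.hasDerivAt_spinorBinormal s).continuousAt
  refine tendsto_limUnder_of_hasDerivAt_of_integrableOn_Ioi (a := 1)
    (f' := fun s => (-(2 * a) * s ^ (-2 : ℝ)) • spinorBinormal w q s) (fun s hs => ?_) ?_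
  · have hs0 : (0 : ℝ) < s := one_pos.trans hs
    refine ((hasDerivAt_inv hs0.ne').smul (h.isFrenetSolution.deriv_G s)).congr_deriv ?_
    rw [Real.rpow_neg hs0.le, Real.rpow_two, spinorCurve, smul_add, smul_smul, smul_smul]
    have : s⁻¹ = (s ^ 2)⁻¹ * s := by field_simp
    rw [this]
    module
  · have h0 := (integrableOn_Ioi_rpow_of_lt (a := -2) (by norm_num) one_pos).const_mul (2 * |a|)
    refine Integrable.mono' h0 ?_ ?_
    · refine ContinuousOn.aestronglyMeasurable ?_ measurableSet_Ioi
      have hr : ContinuousOn (fun s : ℝ => s ^ (-2 : ℝ)) (Ioi 1) :=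
        ContinuousOn.rpow_const continuousOn_id
          fun s hs => Or.inl (one_pos.trans (show (1 : ℝ) < s from hs)).ne'
      exact (continuousOn_const.mul hr).smul hcb.continuousOn
    · refine (ae_restrict_iff' measurableSet_Ioi).mpr (Eventually.of_forall fun s hs => ?_)
      have hs0 : 0 < s := one_pos.trans hs
      rw [norm_smul, h.norm_spinorBinormal, mul_one, norm_mul,
        Real.norm_of_nonneg (Real.rpow_nonneg hs0.le _)]
      simp

theorem tendsto_inv_smul_atBot (h : IsSpinorSolution a w q) {A : E3}
    (hA : Tendsto (fun s : ℝ => s⁻¹ • spinorCurve a w q s) atTop (𝓝 A)) :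
    Tendsto (fun s : ℝ => s⁻¹ • spinorCurve a w q s) atBot
      (𝓝 ((2 * A 0) • (!₂[1, 0, 0] : E3) - A)) := by
  have hc : Continuous fun v : E3 => (2 * v 0) • (!₂[1, 0, 0] : E3) - v := by fun_prop
  refine (((hc.tendsto A).comp hA).comp tendsto_neg_atBot_atTop).congr fun s => ?_
  simp only [Function.comp, h.spinorCurve_neg, PiLp.sub_apply, PiLp.smul_apply, smul_eq_mul,
    inv_neg]
  simp
  module

theorem tendsto_coord_zero (h : IsSpinorSolution a w q) :
    Tendsto (fun s : ℝ => s⁻¹ * spinorCurve a w q s 0) atTop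
      (𝓝 (Real.exp (-(Real.pi * a ^ 2 / 2)))) := by
  have h1 : Tendsto (fun s : ℝ => 2 * ‖w s‖ ^ 2 - 1) atTop
      (𝓝 (Real.exp (-(Real.pi * a ^ 2 / 2)))) := by
    convert (h.tendsto_norm_w_sq.const_mul 2).sub_const 1 using 2
    ring
  have h2 : Tendsto (fun s : ℝ => 2 * a * (s⁻¹ * spinorBinormal w q s 0)) atTop (𝓝 0) := by
    rw [← mul_zero (2 * a)]
    refine Tendsto.const_mul _ ?_
    exact tendsto_inv_atTop_zero.zero_mul_isBoundedUnder_le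
      (isBoundedUnder_of ⟨1, fun x => by simpa using h.abs_binormal_zero_le x⟩)
  have h3 := h1.add h2
  rw [add_zero] at h3
  refine h3.congr' ?_
  filter_upwards [eventually_gt_atTop 0] with s hs
  rw [curve_zero_eq, h.spinorTangent_zero_eq]
  field_simp

theorem norm_limit_eq_one (h : IsSpinorSolution a w q) {A : E3}
    (hA : Tendsto (fun s : ℝ => s⁻¹ • spinorCurve a w q s) atTop (𝓝 A)) : ‖A‖ ^ 2 = 1 := by
  refine tendsto_nhds_unique (hA.norm.pow 2) ?_
  have h1 : Tendsto (fun s : ℝ => 1 + 4 * a ^ 2 * (s⁻¹) ^ 2) atTop (𝓝 1) := by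
    have h0 : Tendsto (fun s : ℝ => s⁻¹) atTop (𝓝 0) := tendsto_inv_atTop_zero
    convert ((h0.pow 2).const_mul (4 * a ^ 2)).const_add 1 using 2
    ring
  refine h1.congr' ?_
  filter_upwards [eventually_gt_atTop 0] with s hs
  rw [norm_smul, mul_pow, h.norm_spinorCurve_sq, Real.norm_eq_abs, sq_abs]
  field_simp

theorem sub_le_curve_zero (h : IsSpinorSolution a w q) {s : ℝ} (hs : 0 ≤ s) :
    s - |a| * s ^ 2 / 2 ≤ spinorCurve a w q s 0 := by
  have hT : ∀ t, 0 ≤ t → 1 - |a| * t ≤ spinorTangent w q t 0 := by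
    intro t ht
    have h1 := le_of_hasDerivAt_nonneg ht
      (fun r _ => (h.hasDerivAt_tangent_zero r).add ((hasDerivAt_id r).const_mul |a|))
      fun r _ => by
        have h2 : |a * spinorNormal w q r 0| ≤ |a| := by
          rw [abs_mul]
          exact mul_le_of_le_one_right (abs_nonneg a) (h.abs_normal_zero_le r)
        have := (abs_le.mp h2).1
        linarith
    simp only [Pi.add_apply, id, h.tangent_zero_at_zero] at h1
    linarith
  have h1 := le_of_hasDerivAt_nonneg hs
    (fun r _ => ((h.hasDerivAt_curve_zero r).sub (hasDerivAt_id r)).add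
      (((hasDerivAt_pow 2 r).const_mul |a|).div_const 2))
    fun r hr => by
      have := hT r hr.1
      push_cast
      linarith
  simp only [Pi.add_apply, Pi.sub_apply, id, h.curve_zero_at_zero] at h1
  linarith

/-- On `(0, 1]` the bound `s - |a| s ^ 2 / 2` suffices. Beyond `1`, `G₁ / s - 2 |a| / s` is
nondecreasing, so `G₁ / s` stays at least `1 - 5 |a| / 2`. -/
theorem curve_zero_pos_of_small (h : IsSpinorSolution a w q) (ha : |a| < 1 / 4) {s : ℝ}
    (hs : 0 < s) : 0 < spinorCurve a w q s 0 := by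
  rcases le_total s 1 with h1 | h1
  · have := h.sub_le_curve_zero hs.le
    nlinarith [abs_nonneg a]
  · have h2 := h.sub_le_curve_zero zero_le_one
    have hd : ∀ t ∈ Icc 1 s, HasDerivAt
        (fun t => t⁻¹ * spinorCurve a w q t 0 - 2 * |a| * t⁻¹)
        ((t ^ 2)⁻¹ * (2 * |a| - 2 * (a * spinorBinormal w q t 0))) t := by
      intro t ht
      have ht0 : 0 < t := one_pos.trans_le ht.1
      refine (((hasDerivAt_inv ht0.ne').mul (h.hasDerivAt_curve_zero t)).sub
        ((hasDerivAt_inv ht0.ne').const_mul (2 * |a|))).congr_deriv ?_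
      rw [curve_zero_eq]
      field_simp
      ring
    have h3 := le_of_hasDerivAt_nonneg h1 hd fun t ht => by
      have h4 : |a * spinorBinormal w q t 0| ≤ |a| := by
        rw [abs_mul]
        exact mul_le_of_le_one_right (abs_nonneg a) (h.abs_binormal_zero_le t)
      have := (abs_le.mp h4).2
      exact mul_nonneg (by positivity) (by linarith)
    have h5 : 0 ≤ 2 * |a| * s⁻¹ := by positivity
    have h6 : 0 < s⁻¹ * spinorCurve a w q s 0 := by
      simp only [inv_one, one_mul, mul_one] at h3
      linarith
    exact (pos_iff_pos_of_mul_pos h6).mp (inv_pos.mpr hs)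

/-- Without torsion, `G₁` would be `sin (a s) / a`. Rotating `(T₁, n₁)` through the angle `a s`
removes the curvature, and each rotated component then moves at speed at most `s / 2`. -/
theorem curve_zero_le (h : IsSpinorSolution a w q) (ha : a ≠ 0) {s : ℝ} (hs : 0 ≤ s) :
    spinorCurve a w q s 0 ≤ Real.sin (a * s) / a + s ^ 3 / 6 := by
  have dm : ∀ t : ℝ, HasDerivAt (fun t : ℝ => a * t) a t := fun t => by
    simpa using (hasDerivAt_id t).const_mul a
  have hb : ∀ t c : ℝ, 0 ≤ t → |c| ≤ 1 → |t / 2 * (spinorBinormal w q t 0 * c)| ≤ t / 2 := by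
    intro t c ht hc
    rw [abs_mul, abs_of_nonneg (by positivity : 0 ≤ t / 2), abs_mul]
    exact mul_le_of_le_one_right (by positivity)
      (mul_le_one₀ (h.abs_binormal_zero_le t) (abs_nonneg c) hc)
  have hT : ∀ t, 0 ≤ t → spinorTangent w q t 0 ≤ Real.cos (a * t) + t ^ 2 / 2 := by
    intro t ht
    have h1 := abs_le_sq_of_abs_deriv_le ht
      (f := fun t => spinorTangent w q t 0 * Real.cos (a * t) -
        spinorNormal w q t 0 * Real.sin (a * t) - 1)
      (f' := fun t => t / 2 * (spinorBinormal w q t 0 * -Real.sin (a * t)))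
      (by simp [h.tangent_zero_at_zero])
      (fun t => ((((h.hasDerivAt_tangent_zero t).mul (dm t).cos).sub
        ((h.hasDerivAt_normal_zero t).mul (dm t).sin)).sub_const 1).congr_deriv (by ring))
      (fun t ht => hb t _ ht (by rw [abs_neg]; exact Real.abs_sin_le_one _))
    have h2 := abs_le_sq_of_abs_deriv_le ht
      (f := fun t => spinorTangent w q t 0 * Real.sin (a * t) +
        spinorNormal w q t 0 * Real.cos (a * t))
      (f' := fun t => t / 2 * (spinorBinormal w q t 0 * Real.cos (a * t)))
      (by simp [h.normal_zero_at_zero])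
      (fun t => (((h.hasDerivAt_tangent_zero t).mul (dm t).sin).add
        ((h.hasDerivAt_normal_zero t).mul (dm t).cos)).congr_deriv (by ring))
      (fun t ht => hb t _ ht (Real.abs_cos_le_one _))
    simp only [] at h1 h2
    set P := spinorTangent w q t 0 * Real.cos (a * t) -
        spinorNormal w q t 0 * Real.sin (a * t) - 1 with hP
    set R := spinorTangent w q t 0 * Real.sin (a * t) +
        spinorNormal w q t 0 * Real.cos (a * t) with hR
    -- Rotating back: `P` and `R` are the deviations of the rotated pair from its initial value `(1,
    -- 0)`.
    have h3 : spinorTangent w q t 0 - Real.cos (a * t) =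
        Real.cos (a * t) * P + Real.sin (a * t) * R := by
      rw [hP, hR]
      linear_combination -(spinorTangent w q t 0) * Real.sin_sq_add_cos_sq (a * t)
    have h4 : Real.cos (a * t) * P ≤ t ^ 2 / 4 := by
      refine (le_abs_self _).trans ?_
      rw [abs_mul]
      exact (mul_le_of_le_one_left (abs_nonneg _) (Real.abs_cos_le_one _)).trans h1
    have h5 : Real.sin (a * t) * R ≤ t ^ 2 / 4 := by
      refine (le_abs_self _).trans ?_
      rw [abs_mul]
      exact (mul_le_of_le_one_left (abs_nonneg _) (Real.abs_sin_le_one _)).trans h2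
    linarith
  have h1 := le_of_hasDerivAt_nonneg hs
    (f := fun t => Real.sin (a * t) / a + t ^ 3 / 6 - spinorCurve a w q t 0)
    (f' := fun t => Real.cos (a * t) + t ^ 2 / 2 - spinorTangent w q t 0)
    (fun t _ => ((((dm t).sin.div_const a).add ((hasDerivAt_pow 3 t).div_const 6)).sub
      (h.hasDerivAt_curve_zero t)).congr_deriv (by push_cast; field_simp; ring))
    fun t ht => by
      have := hT t ht.1
      linarith
  simp only [mul_zero, Real.sin_zero, zero_div, h.curve_zero_at_zero] at h1
  norm_num at h1
  linarith

theorem exists_curve_zero_eq_zero (h : IsSpinorSolution a w q) (ha : 10 < |a|) :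
    ∃ s, 0 < s ∧ spinorCurve a w q s 0 = 0 := by
  have ha0 : 0 < |a| := by linarith
  have hane : a ≠ 0 := abs_pos.mp ha0
  have hpi := Real.pi_gt_three
  have hpi' := Real.pi_lt_d2
  -- At `u` the lower bound for `G₁` is `u / 2`. At `v` the comparison circle is at its lowest value
  -- `-1 / |a|`, and the error `v ^ 3 / 6` is smaller once `a ^ 2` exceeds `9 π ^ 3 / 16`, about
  -- `17.4`.
  set u := 1 / |a| with hu
  set v := 3 * Real.pi / 2 / |a| with hv
  have hu0 : 0 < u := by positivity
  have hv0 : 0 < v := by positivity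
  have huv : u ≤ v := by
    rw [hu, hv]
    gcongr
    linarith
  have h1 : 0 ≤ spinorCurve a w q u 0 := by
    refine le_trans ?_ (h.sub_le_curve_zero hu0.le)
    have : |a| * u = 1 := by rw [hu]; field_simp
    have : |a| * u ^ 2 = u := by rw [pow_two, ← mul_assoc, this, one_mul]
    rw [this]
    linarith
  have h2 : spinorCurve a w q v 0 ≤ 0 := by
    refine (h.curve_zero_le hane hv0.le).trans ?_
    have hsin : Real.sin (3 * Real.pi / 2) = -1 := by
      rw [show 3 * Real.pi / 2 = Real.pi / 2 + Real.pi by ring, Real.sin_add_pi, Real.sin_pi_div_two]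
    have h3 : Real.sin (a * v) / a = -(1 / |a|) := by
      rcases lt_or_gt_of_ne hane with hn | hp
      · rw [hv, abs_of_neg hn, show a * (3 * Real.pi / 2 / -a) = -(3 * Real.pi / 2) by field_simp,
          Real.sin_neg, hsin]
        field_simp
      · rw [hv, abs_of_pos hp, show a * (3 * Real.pi / 2 / a) = 3 * Real.pi / 2 by field_simp, hsin]
        field_simp
    have h4 : v ^ 3 / 6 = (9 * Real.pi ^ 3 / 16 / |a| ^ 2) * (1 / |a|) := by
      rw [hv]; field_simp; ring
    have h5 : 9 * Real.pi ^ 3 / 16 / |a| ^ 2 ≤ 1 := by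
      rw [div_le_one (by positivity)]
      have : Real.pi ^ 3 ≤ 3.15 ^ 3 := by gcongr
      nlinarith
    have h6 := mul_le_of_le_one_left hu0.le h5
    rw [h3, h4]
    linarith
  have hcont : ContinuousOn (fun s => spinorCurve a w q s 0) (Icc u v) := fun s _ =>
    (h.hasDerivAt_curve_zero s).continuousAt.continuousWithinAt
  obtain ⟨s, hs, hs0⟩ := intermediate_value_Icc' huv hcont ⟨h2, h1⟩
  exact ⟨s, hu0.trans_le hs.1, hs0⟩

/-- At a zero of `G₁` where `T₁` also vanishes, `G₁ = s T₁ + 2 a b₁` forces `b₁ = 0`, so `n₁ = ±1`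
and `T₁` has a simple zero. By Rolle, further zeros of `G₁` nearby would produce further zeros of
`T₁`. -/
theorem eventually_curve_zero_ne (h : IsSpinorSolution a w q) (ha : a ≠ 0) (z : ℝ) :
    ∀ᶠ s in 𝓝[≠] z, spinorCurve a w q s 0 ≠ 0 := by
  by_cases hT : spinorTangent w q z 0 = 0
  swap
  · exact (h.hasDerivAt_curve_zero z).eventually_ne hT
  by_cases hG : spinorCurve a w q z 0 = 0
  swap
  · exact ((h.hasDerivAt_curve_zero z).continuousAt.eventually_ne hG).filter_mono
      nhdsWithin_le_nhds
  have hb : spinorBinormal w q z 0 = 0 := by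
    rw [curve_zero_eq, hT, mul_zero, zero_add] at hG
    simpa [ha] using hG
  have hn : a * spinorNormal w q z 0 ≠ 0 := by
    have := h.firstCoord_normSq z
    rw [hT, hb] at this
    refine mul_ne_zero ha fun h0 => ?_
    rw [h0] at this
    norm_num at this
  have h1 := (h.hasDerivAt_tangent_zero z).eventually_ne (c := 0) hn
  rw [eventually_nhdsWithin_iff, Metric.eventually_nhds_iff_ball] at h1 ⊢
  obtain ⟨ε, hε, h1⟩ := h1
  refine ⟨ε, hε, fun s hs hsz hGs => ?_⟩
  have hcont : Continuous fun s => spinorCurve a w q s 0 :=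
    continuous_iff_continuousAt.mpr fun s => (h.hasDerivAt_curve_zero s).continuousAt
  have hz : z ∈ Metric.ball z ε := Metric.mem_ball_self hε
  have hconv := (convex_ball z ε).ordConnected
  rcases lt_or_gt_of_ne (show s ≠ z from hsz) with hlt | hlt
  · obtain ⟨t, ht, ht0⟩ := exists_hasDerivAt_eq_zero hlt hcont.continuousOn (hGs.trans hG.symm)
      fun t _ => h.hasDerivAt_curve_zero t
    exact h1 t (hconv.out hs hz (Ioo_subset_Icc_self ht)) ht.2.ne ht0
  · obtain ⟨t, ht, ht0⟩ := exists_hasDerivAt_eq_zero hlt hcont.continuousOn (hG.trans hGs.symm)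
      fun t _ => h.hasDerivAt_curve_zero t
    exact h1 t (hconv.out hz hs (Ioo_subset_Icc_self ht)) ht.1.ne' ht0

/-- The limit of `G₁ / s` is positive, so the zeros lie in a compact interval; infinitely many would
accumulate, but they are isolated. -/
theorem finite_zeros (h : IsSpinorSolution a w q) (ha : a ≠ 0) :
    {s | 0 < s ∧ spinorCurve a w q s 0 = 0}.Finite := by
  obtain ⟨S, hS⟩ := eventually_atTop.mp
    (h.tendsto_coord_zero.eventually_const_lt (Real.exp_pos _))
  by_contra hinf
  have hsub : {s | 0 < s ∧ spinorCurve a w q s 0 = 0} ⊆ Icc 0 S := by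
    rintro s ⟨hs, hs0⟩
    refine ⟨hs.le, le_of_not_ge fun hle => ?_⟩
    have := hS s hle
    rw [hs0, mul_zero] at this
    exact this.false
  obtain ⟨z, -, hz⟩ := Set.Infinite.exists_accPt_of_subset_isCompact hinf isCompact_Icc hsub
  rw [accPt_iff_frequently_nhdsNE] at hz
  exact hz ((h.eventually_curve_zero_ne ha z).mono fun s hs hs' => hs hs'.2)

/-- Equal norms force `s = ±t`, and distinctness leaves `s = -t`. The even coordinates then agree
automatically, and the odd one agrees exactly when it vanishes. -/
theorem mem_selfIntersections_iff (h : IsSpinorSolution a w q) (p : ℝ × ℝ) :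
    p ∈ selfIntersections (spinorCurve a w q) ↔
      0 < p.2 ∧ p.1 = -p.2 ∧ spinorCurve a w q p.2 0 = 0 := by
  obtain ⟨s, t⟩ := p
  constructor
  · rintro ⟨hlt, heq⟩
    simp only at hlt heq
    have h1 := h.norm_spinorCurve_sq s
    rw [heq, h.norm_spinorCurve_sq t] at h1
    have h2 : s = -t := by
      have : (t - s) * (t + s) = 0 := by linarith
      rcases mul_eq_zero.mp this with h3 | h3 <;> linarith
    refine ⟨by simp only; linarith, h2, ?_⟩
    rw [h2] at heq
    have h3 := congrArg (fun v : E3 => v 0) heq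
    simp only [h.spinorCurve_neg_zero] at h3
    simp only
    linarith
  · rintro ⟨hpos, hneg, hzero⟩
    simp only at hpos hneg hzero
    refine ⟨by simp only; linarith, ?_⟩
    simp only
    rw [hneg, h.spinorCurve_neg, hzero, mul_zero, zero_smul, sub_zero]

end IsSpinorSolution

/-! ### The vectors `A⁺`, `A⁻` and the conclusion -/

theorem tendsto_Aplus (a : ℝ) :
    Tendsto (fun s : ℝ => s⁻¹ • profile a s) atTop (𝓝 (Aplus a)) := by
  obtain ⟨w, q, h⟩ := exists_isSpinorSolution a
  rw [Aplus, h.profile_eq]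
  exact h.tendsto_inv_smul_atTop

theorem tendsto_profile_atBot (a : ℝ) :
    Tendsto (fun s : ℝ => s⁻¹ • profile a s) atBot
      (𝓝 ((2 * Aplus a 0) • (!₂[1, 0, 0] : E3) - Aplus a)) := by
  obtain ⟨w, q, h⟩ := exists_isSpinorSolution a
  have hA := tendsto_Aplus a
  rw [h.profile_eq] at hA ⊢
  exact h.tendsto_inv_smul_atBot hA

theorem Aminus_eq (a : ℝ) : Aminus a = (2 * Aplus a 0) • (!₂[1, 0, 0] : E3) - Aplus a :=
  (tendsto_profile_atBot a).limUnder_eq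

theorem Aplus_zero_eq (a : ℝ) : Aplus a 0 = Real.exp (-(Real.pi * a ^ 2 / 2)) := by
  obtain ⟨w, q, h⟩ := exists_isSpinorSolution a
  have hA := tendsto_Aplus a
  rw [h.profile_eq] at hA
  have h1 := ((EuclideanSpace.proj (𝕜 := ℝ) (0 : Fin 3)).continuous.tendsto _).comp hA
  exact tendsto_nhds_unique h1 (h.tendsto_coord_zero.congr fun s => by simp)

theorem norm_Aplus_sq (a : ℝ) : ‖Aplus a‖ ^ 2 = 1 := by
  obtain ⟨w, q, h⟩ := exists_isSpinorSolution a
  have hA := tendsto_Aplus a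
  rw [h.profile_eq] at hA
  exact h.norm_limit_eq_one hA

/-- Equality with the reflected vector means that the last two coordinates vanish. For a unit vector
with first coordinate `exp (-π a ^ 2 / 2) > 0` this happens exactly when the exponential is `1`. -/
theorem Aplus_eq_Aminus_iff (a : ℝ) : Aplus a = Aminus a ↔ a = 0 := by
  have hn := norm_Aplus_sq a
  have h0 := Aplus_zero_eq a
  rw [EuclideanSpace.norm_sq_eq, Fin.sum_univ_three] at hn
  simp only [Real.norm_eq_abs, sq_abs] at hn
  constructor
  · intro heq
    rw [Aminus_eq] at heq
    have h1 := congrArg (fun v : E3 => v 1) heq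
    have h2 := congrArg (fun v : E3 => v 2) heq
    simp at h1 h2
    have h1' : Aplus a 1 = 0 := by linarith
    have h2' : Aplus a 2 = 0 := by linarith
    rw [h1', h2', h0] at hn
    have h3 : Real.exp (-(Real.pi * a ^ 2 / 2)) = 1 := by
      have := Real.exp_pos (-(Real.pi * a ^ 2 / 2))
      nlinarith
    rw [Real.exp_eq_one_iff] at h3
    have := Real.pi_pos.ne'
    simpa [this] using h3
  · rintro rfl
    simp at h0
    rw [h0] at hn
    have h1 : Aplus 0 1 = 0 := by nlinarith [sq_nonneg (Aplus 0 1), sq_nonneg (Aplus 0 2)]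
    have h2 : Aplus 0 2 = 0 := by nlinarith [sq_nonneg (Aplus 0 1), sq_nonneg (Aplus 0 2)]
    rw [Aminus_eq]
    ext i
    fin_cases i
    · simp [h0]; norm_num
    · simp [h1]
    · simp [h2]

theorem mainTheorem7 :
    -- the curves `G_a` and the vectors `A⁺_a`, `A⁻_a` are well defined
    (∀ a : ℝ, IsProfile a (profile a) ∧ (∀ G : ℝ → E3, IsProfile a G → G = profile a) ∧
      Filter.Tendsto (fun s : ℝ => s⁻¹ • profile a s) Filter.atTop (nhds (Aplus a)) ∧
      Filter.Tendsto (fun s : ℝ => s⁻¹ • profile a s) Filter.atBot (nhds (Aminus a))) ∧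
    (∀ a : ℝ, Aplus a ≠ -Aminus a) ∧
    (∀ a : ℝ, Aplus a = Aminus a ↔ a = 0) ∧
    (∃ a₁ a₂ : ℝ, 0 < a₁ ∧
      (∀ a : ℝ, |a| < a₁ → selfIntersections (profile a) = ∅) ∧
      (∀ a : ℝ, a₂ < |a| →
        (selfIntersections (profile a)).Nonempty ∧ (selfIntersections (profile a)).Finite)) := by
  refine ⟨fun a => ⟨isProfile_profile a, fun G hG => hG.eq_profile, tendsto_Aplus a, ?_⟩, ?_,
    Aplus_eq_Aminus_iff, 1 / 4, 10, by norm_num, ?_, ?_⟩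
  · rw [Aminus_eq]
    exact tendsto_profile_atBot a
  · intro a heq
    rw [Aminus_eq] at heq
    have h1 := congrArg (fun v : E3 => v 0) heq
    simp at h1
    have h2 := Aplus_zero_eq a
    have h3 := Real.exp_pos (-(Real.pi * a ^ 2 / 2))
    linarith
  · intro a ha
    obtain ⟨w, q, h⟩ := exists_isSpinorSolution a
    rw [h.profile_eq, eq_empty_iff_forall_notMem]
    intro p hp
    obtain ⟨hpos, -, hzero⟩ := (h.mem_selfIntersections_iff p).mp hp
    exact (h.curve_zero_pos_of_small ha hpos).ne' hzero
  · intro a ha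
    obtain ⟨w, q, h⟩ := exists_isSpinorSolution a
    have hane : a ≠ 0 := abs_pos.mp (by linarith)
    rw [h.profile_eq]
    constructor
    · obtain ⟨s, hs, hs0⟩ := h.exists_curve_zero_eq_zero ha
      exact ⟨(-s, s), (h.mem_selfIntersections_iff _).mpr ⟨hs, rfl, hs0⟩⟩
    · refine ((h.finite_zeros hane).image fun s => (-s, s)).subset fun p hp => ?_
      obtain ⟨hpos, hneg, hzero⟩ := (h.mem_selfIntersections_iff p).mp hp
      exact ⟨p.2, ⟨hpos, hzero⟩, Prod.ext hneg.symm rfl⟩
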